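/- For positive integers $A, a$ and a partition $\lambda$ of $n$, let $\mathrm{mex}_{A,a}(\lambda)$ be the smallest positive integer congruent to $a$ modulo $A$ that is not a part of $\lambda$, and let $p_{A,a}(n)$ be the number of partitions $\lambda$ of $n$ with $\mathrm{mex}_{A,a}(\lambda) \equiv a \pmod{2A}$. A pentagonal number is a number $k(3k-1)/2$, and a triangular number is a number $k(k+1)/2$, where $k \ge 1$ is an integer. Theorem. (1) For all integers $n \ge 0$, $p_{3,3}(16n+11) \equiv p_{3,3}(16n+15) \equiv 0 \pmod 2$. (2) If $n \ge 0$ is an integer that cannot be represented as the sum of a pentagonal number and four times a pentagonal number, then $p_{3,3}(16n+3) \equiv 0 \pmod 2$. (3) If $n \ge 0$ is an integer that cannot be represented as the sum of two times a pentagonal number and three times a triangular number, then $p_{3,3}(16n+7) \equiv 0 \pmod 2$. -/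

import Mathlib

namespace MexPartition

/-- The minimal excludant `mex_{A,a}(l)` of a partition `l`: the smallest positive integer
congruent to `a` modulo `A` that is not a part of `l`. For `A > 0` such integers exist
(`mex_isLeast`). -/
noncomputable def mex (A a : ℕ) {n : ℕ} (l : n.Partition) : ℕ :=
  sInf {m : ℕ | 0 < m ∧ m ≡ a [MOD A] ∧ m ∉ l.parts}

theorem mex_isLeast {A : ℕ} (hA : 0 < A) (a : ℕ) {n : ℕ} (l : n.Partition) :
    IsLeast {m : ℕ | 0 < m ∧ m ≡ a [MOD A] ∧ m ∉ l.parts} (mex A a l) := by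
  have hne : {m : ℕ | 0 < m ∧ m ≡ a [MOD A] ∧ m ∉ l.parts}.Nonempty := by
    have hle : n + 1 ≤ A * (n + 1) := Nat.le_mul_of_pos_left _ hA
    refine ⟨a + A * (n + 1), by omega, ?_, fun h => ?_⟩
    · simp [Nat.ModEq]
    · have := l.le_of_mem_parts h
      omega
  exact ⟨Nat.sInf_mem hne, fun _ hm => Nat.sInf_le hm⟩

/-- `p_{A,a}(n)`: the number of partitions `l` of `n` with `mex_{A,a}(l) ≡ a (mod 2A)`. -/
noncomputable def mexCount (A a n : ℕ) : ℕ :=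
  Nat.card {l : n.Partition // mex A a l ≡ a [MOD 2 * A]}

/-- The pentagonal numbers `k(3k-1)/2`, `k ≥ 1`, that is `1, 5, 12, 22, …`. -/
def IsPentagonal (m : ℕ) : Prop :=
  ∃ k : ℕ, 1 ≤ k ∧ m = pentagonal k

/-- The triangular numbers `k(k+1)/2`, `k ≥ 1`, that is `1, 3, 6, 10, …`. -/
def IsTriangular (m : ℕ) : Prop :=
  ∃ k : ℕ, 1 ≤ k ∧ m = k * (k + 1) / 2

end MexPartition

/-!
The number `p_{3,3}(m)` is even for every `m ≡ 3 (mod 4)`, and all four progressions modulo `16`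
consist of such `m`.

All series are taken modulo two. If `c` is the largest `k` such that `3, 6, …, 3k` are parts of a
partition, its mex is `3(c + 1)`, so the partition is counted exactly when the number `c + 1` of
such `k ≥ 0` is odd. Hence the generating function of `p_{3,3}` is `M = T P`, where `P` is the
generating function of all partitions and `T = ∑ X ^ (3k(k+1)/2)` (`mk_mexCount_three_three`).
By the pentagonal number theorem `P E = 1` with `E = ∑ X ^ (k(3k-1)/2)`, the sum over all integers.

Let `Ψ = ∑ X ^ (k(k+1)/2)`. Then `E(X) Ψ(X) = E(X ^ 4)` (`squareSeries_mul_eq`), whence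
`M(X) = T(X) Ψ(X) P(X ^ 4)`. The last factor has only exponents divisible by four, so it is enough
that `T Ψ` has no exponents `4n + 3` (`coeff_squareSeries_mul_four_mul_add_three`).

After completing squares, the coefficients of `E Ψ` and of `T Ψ` both count solutions of
`x ^ 2 + 3 y ^ 2 = 4m` in odd positive integers. Multiplying `(x + y√-3) / 2` by a cube root of unity
gives an involution on these solutions (`rotate`), with fixed points only for `x = y` and `x = 3y`,
that is, for `m` a square or three times a square. This settles the parity in both cases.
-/

open PowerSeries

namespace MexPartition

/-! ### Odd representations by the form `x ^ 2 + 3 * y ^ 2` -/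

/-- The representations `x ^ 2 + 3 * y ^ 2 = 4 * m` with `x`, `y` odd and positive. -/
def oddReps (m : ℕ) : Finset (ℕ × ℕ) :=
  {p ∈ Finset.range (4 * m + 1) ×ˢ Finset.range (4 * m + 1) |
    Odd p.1 ∧ Odd p.2 ∧ p.1 ^ 2 + 3 * p.2 ^ 2 = 4 * m}

theorem mem_oddReps {m : ℕ} {p : ℕ × ℕ} :
    p ∈ oddReps m ↔ Odd p.1 ∧ Odd p.2 ∧ p.1 ^ 2 + 3 * p.2 ^ 2 = 4 * m := by
  simp only [oddReps, Finset.mem_filter, Finset.mem_product, Finset.mem_range,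
    and_iff_right_iff_imp]
  rintro ⟨-, -, h⟩
  constructor <;> nlinarith

/-- Multiplication of `z = (x + y√-3) / 2` by a primitive cube root of unity, up to the signs of the
two coordinates. Exactly one of `ωz` and `ω²z` has odd coordinates again when `x` and `y` are odd,
and the residues of `x` and `y` modulo `4` decide which; that one is taken. -/
def rotate (p : ℕ × ℕ) : ℕ × ℕ :=
  if p.1 % 4 = p.2 % 4 then (((p.1 : ℤ) - 3 * p.2).natAbs / 2, (p.1 + p.2) / 2)
  else ((p.1 + 3 * p.2) / 2, ((p.1 : ℤ) - p.2).natAbs / 2)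

theorem rotate_rotate {p : ℕ × ℕ} (h₁ : Odd p.1) (h₂ : Odd p.2) : rotate (rotate p) = p := by
  obtain ⟨x, y⟩ := p
  rw [Nat.odd_iff] at h₁ h₂
  dsimp only at h₁ h₂
  simp only [rotate]
  split_ifs <;> simp only [Prod.mk.injEq] <;> omega

theorem rotate_mem_oddReps {m : ℕ} {p : ℕ × ℕ} (hp : p ∈ oddReps m) : rotate p ∈ oddReps m := by
  rw [mem_oddReps] at hp ⊢
  obtain ⟨x, y⟩ := p
  obtain ⟨h₁, h₂, h⟩ := hp
  rw [Nat.odd_iff] at h₁ h₂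
  dsimp only at h₁ h₂ h
  simp only [rotate, Nat.odd_iff]
  split_ifs <;> refine ⟨by omega, by omega, ?_⟩
  · have e₁ : (2 * (((((x : ℤ) - 3 * y).natAbs / 2 : ℕ)) : ℤ)) ^ 2 = (x - 3 * y) ^ 2 := by
      rw [sq_eq_sq_iff_eq_or_eq_neg]; omega
    have e₂ : 2 * (((x + y) / 2 : ℕ) : ℤ) = x + y := by omega
    zify at h ⊢
    push_cast at e₁ e₂
    nlinarith
  · have e₁ : (2 * (((((x : ℤ) - y).natAbs / 2 : ℕ)) : ℤ)) ^ 2 = (x - y) ^ 2 := by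
      rw [sq_eq_sq_iff_eq_or_eq_neg]; omega
    have e₂ : 2 * (((x + 3 * y) / 2 : ℕ) : ℤ) = x + 3 * y := by omega
    zify at h ⊢
    push_cast at e₁ e₂
    nlinarith

theorem rotate_eq_self_iff {p : ℕ × ℕ} (h₁ : Odd p.1) (h₂ : Odd p.2) :
    rotate p = p ↔ p.1 = p.2 ∨ p.1 = 3 * p.2 := by
  obtain ⟨x, y⟩ := p
  rw [Nat.odd_iff] at h₁ h₂
  dsimp only at h₁ h₂
  simp only [rotate]
  split_ifs <;> simp only [Prod.mk.injEq] <;> omega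

/-- As `rotate` is an involution, only its fixed points matter for the parity of the number of odd
representations. -/
theorem card_oddReps (m : ℕ) :
    ((oddReps m).card : ZMod 2) =
      ((oddReps m).filter fun p ↦ p.1 = p.2 ∨ p.1 = 3 * p.2).card := by
  rw [← Finset.card_filter_add_card_filter_not (s := oddReps m)
    (fun p ↦ p.1 = p.2 ∨ p.1 = 3 * p.2), Nat.cast_add, add_eq_left, Finset.cast_card]
  refine Finset.sum_involution (fun p _ ↦ rotate p) (fun _ _ ↦ by decide) ?_ ?_ ?_
  · intro p hp _
    obtain ⟨hp, hne⟩ := Finset.mem_filter.mp hp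
    obtain ⟨h₁, h₂, -⟩ := mem_oddReps.mp hp
    rwa [Ne, rotate_eq_self_iff h₁ h₂]
  · intro p hp
    obtain ⟨hp, hne⟩ := Finset.mem_filter.mp hp
    obtain ⟨h₁, h₂, -⟩ := mem_oddReps.mp hp
    have hr := rotate_mem_oddReps hp
    obtain ⟨h₁', h₂', -⟩ := mem_oddReps.mp hr
    rw [Finset.mem_filter, ← rotate_eq_self_iff h₁' h₂', rotate_rotate h₁ h₂]
    rw [← rotate_eq_self_iff h₁ h₂] at hne
    exact ⟨hr, fun h ↦ hne h.symm⟩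
  · intro p hp
    obtain ⟨hp, hne⟩ := Finset.mem_filter.mp hp
    obtain ⟨h₁, h₂, -⟩ := mem_oddReps.mp hp
    exact rotate_rotate h₁ h₂

theorem exists_eight_mul_add_one {x : ℕ} (hx : Odd x) : ∃ k, x * x = 8 * k + 1 := by
  obtain ⟨j, rfl⟩ := hx
  obtain ⟨k, hk⟩ := even_iff_two_dvd.mp (Nat.even_mul_succ_self j)
  exact ⟨k, by nlinarith⟩

theorem odd_of_mul_self_eq {x k : ℕ} (h : 2 * k + 1 = x * x) : Odd x :=
  (Nat.odd_mul.mp (h ▸ ⟨k, rfl⟩ : Odd (x * x))).1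

theorem exists_odd_of_mul_self_eq {s a : ℕ} (h : 24 * a + 9 = s * s) :
    ∃ y, Odd y ∧ s = 3 * y := by
  obtain ⟨y, rfl⟩ : 3 ∣ s := by
    have : 3 ∣ s * s := ⟨8 * a + 3, by omega⟩
    simpa [Nat.prime_three.dvd_mul] using this
  exact ⟨y, (Nat.odd_mul.mp (odd_of_mul_self_eq (x := 3 * y) (k := 12 * a + 4) (by omega))).2, rfl⟩

/-- A fixed point of `rotate` would make `8 * n + 7` a square or three times a square, but odd ones
are `1` or `3` modulo `8`. -/
theorem card_oddReps_eight_mul_add_seven (n : ℕ) : ((oddReps (8 * n + 7)).card : ZMod 2) = 0 := by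
  rw [card_oddReps, Finset.filter_false_of_mem, Finset.card_empty, Nat.cast_zero]
  rintro ⟨x, y⟩ hp
  obtain ⟨-, ⟨k, hy⟩, h⟩ := mem_oddReps.mp hp
  dsimp only at hy h ⊢
  subst hy
  have hk : 2 ∣ k * (k + 1) := even_iff_two_dvd.mp (Nat.even_mul_succ_self k)
  rintro (rfl | rfl) <;> ring_nf at h hk <;> omega

/-- The only possible fixed point of `rotate` is `(s, s)` with `s ^ 2 = 6 * n + 1`, since
`6 * n + 1` is not divisible by three. -/
theorem card_oddReps_six_mul_add_one (n : ℕ) :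
    ((oddReps (6 * n + 1)).card : ZMod 2) = if IsSquare (6 * n + 1) then 1 else 0 := by
  rw [card_oddReps]
  split_ifs with hs
  · obtain ⟨s, hs⟩ := hs
    suffices h : (oddReps (6 * n + 1)).filter (fun p ↦ p.1 = p.2 ∨ p.1 = 3 * p.2) = {(s, s)} by
      rw [h, Finset.card_singleton, Nat.cast_one]
    ext ⟨x, y⟩
    simp only [Finset.mem_filter, mem_oddReps, Finset.mem_singleton, Prod.mk.injEq]
    constructor
    · rintro ⟨⟨-, -, h⟩, rfl | rfl⟩
      · have : x ^ 2 = s ^ 2 := by nlinarith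
        simpa using this
      · ring_nf at h; omega
    · rintro ⟨hxs, hys⟩
      rw [hxs, hys]
      have hx : Odd s := odd_of_mul_self_eq (k := 3 * n) (by omega)
      exact ⟨⟨hx, hx, by rw [hs]; ring⟩, Or.inl rfl⟩
  · rw [Finset.filter_false_of_mem, Finset.card_empty, Nat.cast_zero]
    rintro ⟨x, y⟩ hp
    obtain ⟨-, -, h⟩ := mem_oddReps.mp hp
    dsimp only at h ⊢
    rintro (rfl | rfl)
    · exact hs ⟨x, by nlinarith⟩
    · ring_nf at h; omega

/-! ### Theta series modulo two -/

/-- The series `∑ X ^ n` over those `n` for which `c * n + r` is a perfect square, modulo two.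
The exponents are the generalized pentagonal numbers for `(c, r) = (24, 1)`, their fourfolds for
`(6, 1)`, the triangular numbers (with zero) for `(8, 1)`, and their triples for `(24, 9)`. -/
noncomputable def squareSeries (c r : ℕ) : (ZMod 2)⟦X⟧ :=
  .mk fun n ↦ if IsSquare (c * n + r) then 1 else 0

theorem coeff_squareSeries_mul (c r d s n : ℕ) :
    (squareSeries c r * squareSeries d s).coeff n =
      ((Finset.HasAntidiagonal.antidiagonal n).filter
        fun p ↦ IsSquare (c * p.1 + r) ∧ IsSquare (d * p.2 + s)).card := by
  rw [coeff_mul, Finset.card_filter]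
  simp [squareSeries, ← ite_and, and_comm]

/-- Modulo two, the pentagonal series times the triangular series is the pentagonal series in
`X ^ 4`: a pair of exponents with sum `n` is an odd representation of `4 * (6 * n + 1)`. -/
theorem squareSeries_mul_eq :
    squareSeries 24 1 * squareSeries 8 1 = squareSeries 6 1 := by
  ext n
  rw [coeff_squareSeries_mul]
  simp only [squareSeries, coeff_mk]
  rw [← card_oddReps_six_mul_add_one]
  congr 1
  -- `x ^ 2 = 24 * a + 1` and `y ^ 2 = 8 * b + 1` give `x ^ 2 + 3 * y ^ 2 = 24 * (a + b) + 4`.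
  refine Finset.card_nbij' (fun p ↦ (Nat.sqrt (24 * p.1 + 1), Nat.sqrt (8 * p.2 + 1)))
    (fun p ↦ ((p.1 * p.1 - 1) / 24, (p.2 * p.2 - 1) / 8)) ?_ ?_ ?_ ?_
  · rintro ⟨a, b⟩ hp
    simp only [Finset.coe_filter, Finset.HasAntidiagonal.mem_antidiagonal, Set.mem_ofPred_eq] at hp
    obtain ⟨hn, ⟨x, hx⟩, y, hy⟩ := hp
    simp only [SetLike.mem_coe, mem_oddReps, hx, hy, Nat.sqrt_eq]
    exact ⟨odd_of_mul_self_eq (k := 12 * a) (by omega),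
      odd_of_mul_self_eq (k := 4 * b) (by omega), by nlinarith⟩
  · rintro ⟨x, y⟩ hp
    obtain ⟨hx, hy, h⟩ := mem_oddReps.mp hp
    dsimp only at hx hy h
    obtain ⟨i, hi⟩ := exists_eight_mul_add_one hx
    obtain ⟨j, hj⟩ := exists_eight_mul_add_one hy
    have h' : 8 * i + 1 + 3 * (8 * j + 1) = 4 * (6 * n + 1) := by
      rw [← hi, ← hj, ← h]; ring
    simp only [Finset.coe_filter, Finset.HasAntidiagonal.mem_antidiagonal, Set.mem_ofPred_eq,
      hi, hj]
    exact ⟨by omega, ⟨x, by omega⟩, y, by omega⟩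
  · rintro ⟨a, b⟩ hp
    simp only [Finset.coe_filter, Finset.HasAntidiagonal.mem_antidiagonal, Set.mem_ofPred_eq] at hp
    obtain ⟨hn, ⟨x, hx⟩, y, hy⟩ := hp
    simp only [hx, hy, Nat.sqrt_eq, Prod.mk.injEq]
    omega
  · rintro ⟨x, y⟩ hp
    obtain ⟨hx, hy, h⟩ := mem_oddReps.mp hp
    dsimp only at hx hy h
    obtain ⟨i, hi⟩ := exists_eight_mul_add_one hx
    obtain ⟨j, hj⟩ := exists_eight_mul_add_one hy
    have h' : 8 * i + 1 + 3 * (8 * j + 1) = 4 * (6 * n + 1) := by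
      rw [← hi, ← hj, ← h]; ring
    simp only [Prod.mk.injEq]
    rw [show 24 * ((x * x - 1) / 24) + 1 = x * x by omega,
      show 8 * ((y * y - 1) / 8) + 1 = y * y by omega]
    simp

/-- A pair of a tripled and a plain triangular number with sum `4 * n + 3` is an odd representation
of `4 * (8 * n + 7)`, and the number of those is even. -/
theorem coeff_squareSeries_mul_four_mul_add_three (n : ℕ) :
    (squareSeries 24 9 * squareSeries 8 1).coeff (4 * n + 3) = 0 := by
  rw [coeff_squareSeries_mul, ← card_oddReps_eight_mul_add_seven n]
  congr 1
  -- `(3 * y) ^ 2 = 24 * a + 9` and `x ^ 2 = 8 * b + 1` give `x ^ 2 + 3 * y ^ 2 = 8 * (a + b) + 4`.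
  refine Finset.card_nbij' (fun p ↦ (Nat.sqrt (8 * p.2 + 1), Nat.sqrt (24 * p.1 + 9) / 3))
    (fun p ↦ ((3 * (p.2 * p.2) - 3) / 8, (p.1 * p.1 - 1) / 8)) ?_ ?_ ?_ ?_
  · rintro ⟨a, b⟩ hp
    simp only [Finset.coe_filter, Finset.HasAntidiagonal.mem_antidiagonal, Set.mem_ofPred_eq] at hp
    obtain ⟨hn, ⟨y, hy⟩, x, hx⟩ := hp
    obtain ⟨y, hyo, rfl⟩ := exists_odd_of_mul_self_eq hy
    simp only [SetLike.mem_coe, mem_oddReps, hx, hy, Nat.sqrt_eq]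
    rw [Nat.mul_div_cancel_left y (by omega)]
    exact ⟨odd_of_mul_self_eq (k := 4 * b) (by omega), hyo, by nlinarith⟩
  · rintro ⟨x, y⟩ hp
    obtain ⟨hx, hy, h⟩ := mem_oddReps.mp hp
    dsimp only at hx hy h
    obtain ⟨i, hi⟩ := exists_eight_mul_add_one hx
    obtain ⟨j, hj⟩ := exists_eight_mul_add_one hy
    have h' : 8 * i + 1 + 3 * (8 * j + 1) = 4 * (8 * n + 7) := by
      rw [← hi, ← hj, ← h]; ring
    simp only [Finset.coe_filter, Finset.HasAntidiagonal.mem_antidiagonal, Set.mem_ofPred_eq,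
      hi, hj]
    refine ⟨by omega, ⟨3 * y, ?_⟩, x, by omega⟩
    rw [show 3 * y * (3 * y) = 9 * (y * y) by ring]
    omega
  · rintro ⟨a, b⟩ hp
    simp only [Finset.coe_filter, Finset.HasAntidiagonal.mem_antidiagonal, Set.mem_ofPred_eq] at hp
    obtain ⟨hn, ⟨y, hy⟩, x, hx⟩ := hp
    obtain ⟨y, -, rfl⟩ := exists_odd_of_mul_self_eq hy
    rw [show 3 * y * (3 * y) = 9 * (y * y) by ring] at hy
    simp only [hx, hy, Nat.sqrt_eq, Prod.mk.injEq]
    rw [show 9 * (y * y) = 3 * y * (3 * y) by ring, Nat.sqrt_eq,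
      Nat.mul_div_cancel_left y (by omega)]
    omega
  · rintro ⟨x, y⟩ hp
    obtain ⟨hx, hy, h⟩ := mem_oddReps.mp hp
    dsimp only at hx hy h
    obtain ⟨i, hi⟩ := exists_eight_mul_add_one hx
    obtain ⟨j, hj⟩ := exists_eight_mul_add_one hy
    simp only [Prod.mk.injEq]
    rw [show 8 * ((x * x - 1) / 8) + 1 = x * x by omega,
      show 24 * ((3 * (y * y) - 3) / 8) + 9 = 9 * (y * y) by omega,
      show 9 * (y * y) = 3 * y * (3 * y) by ring, Nat.sqrt_eq, Nat.sqrt_eq,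
      Nat.mul_div_cancel_left y (by omega)]
    simp

theorem isSquare_iff_mem_range_pentagonal (n : ℕ) :
    IsSquare (24 * n + 1) ↔ n ∈ Set.range pentagonal := by
  constructor
  · rintro ⟨s, hs⟩
    have h6 : s % 6 = 1 ∨ s % 6 = 5 := by
      have : (24 * n + 1) % 6 = 1 := by omega
      rw [hs, Nat.mul_mod] at this
      have := Nat.mod_lt s (show 6 > 0 by omega)
      interval_cases s % 6 <;> simp_all
    obtain ⟨k, hk⟩ : ∃ k : ℤ, (s : ℤ) = 6 * k - 1 ∨ (s : ℤ) = -(6 * k - 1) := by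
      rcases h6 with h | h
      · exact ⟨-(s / 6 : ℕ), by omega⟩
      · exact ⟨(s / 6 : ℕ) + 1, by omega⟩
    refine ⟨k, ?_⟩
    have h2 := two_mul_natCast_pentagonal k
    zify at hs ⊢
    rcases hk with hk | hk <;> rw [hk] at hs <;> linarith
  · rintro ⟨k, rfl⟩
    refine ⟨(6 * k - 1).natAbs, ?_⟩
    have h2 := two_mul_natCast_pentagonal k
    zify
    rw [abs_mul_abs_self]
    linarith

theorem pentagonalSeries_zmod_two : pentagonalSeries (ZMod 2) = squareSeries 24 1 := by
  ext n
  simp only [squareSeries, coeff_mk]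
  split_ifs with h
  · obtain ⟨k, rfl⟩ := (isSquare_iff_mem_range_pentagonal n).mp h
    rw [coeff_pentagonalSeries_pentagonal]
    rcases Int.even_or_odd k with hk | hk
    · simp [Int.negOnePow_even k hk]
    · simp [Int.negOnePow_odd k hk]
  · exact coeff_pentagonalSeries_eq_zero _ (mt (isSquare_iff_mem_range_pentagonal n).mpr h)

theorem expand_squareSeries :
    (squareSeries 24 1).expand 4 four_ne_zero = squareSeries 6 1 := by
  ext n
  rw [coeff_expand]
  simp only [squareSeries, coeff_mk]
  by_cases h4 : 4 ∣ n
  · obtain ⟨n, rfl⟩ := h4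
    rw [if_pos (dvd_mul_right 4 n), Nat.mul_div_cancel_left n four_pos,
      show 6 * (4 * n) = 24 * n by ring]
  · rw [if_neg h4, if_neg]
    rintro ⟨s, hs⟩
    obtain ⟨k, hk⟩ := exists_eight_mul_add_one (odd_of_mul_self_eq (x := s) (k := 3 * n) (by omega))
    omega

/-! ### Generating functions of partitions and of the mex count -/

open scoped PowerSeries.WithPiTopology in
/-- The pentagonal number theorem: the generating function of partitions is the inverse of the
pentagonal series. -/
theorem mk_card_partition_mul_pentagonalSeries (R : Type*) [CommRing R] [NoZeroDivisors R] :
    (.mk fun n ↦ (Fintype.card n.Partition : R)) * pentagonalSeries R = 1 := by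
  let : TopologicalSpace R := ⊥
  have : DiscreteTopology R := ⟨rfl⟩
  have h := (Nat.Partition.hasProd_powerSeriesMk_card_restricted R (fun _ ↦ True)).mul
    (WithPiTopology.hasProd_one_sub_X_pow R)
  simp only [if_true, pow_mul] at h
  simp_rw [WithPiTopology.tsum_pow_mul_one_sub_of_constantCoeff_eq_zero
    (show constantCoeff ((X : R⟦X⟧) ^ (_ + 1)) = 0 by simp)] at h
  simpa [Nat.Partition.restricted] using h.unique hasProd_one

/-- Removing the parts in `s` is a bijection from the partitions of `n` that contain `s`. -/
theorem card_filter_le_parts {s : Multiset ℕ} (hs : ∀ i ∈ s, 0 < i) {n : ℕ} (hn : s.sum ≤ n) :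
    (Finset.univ.filter fun l : n.Partition ↦ s ≤ l.parts).card =
      Fintype.card (n - s.sum).Partition := by
  rw [← Finset.card_univ]
  refine Finset.card_bij'
    (fun l hl ↦ ⟨l.parts - s, fun hi ↦ l.parts_pos (Multiset.mem_of_le tsub_le_self hi), ?_⟩)
    (fun l _ ↦ ⟨l.parts + s, fun hi ↦ (Multiset.mem_add.mp hi).elim l.parts_pos (hs _), ?_⟩)
    ?_ ?_ ?_ ?_
  · have := congrArg Multiset.sum (tsub_add_cancel_of_le (Finset.mem_filter.mp hl).2)
    rw [Multiset.sum_add, l.parts_sum] at this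
    omega
  · rw [Multiset.sum_add, l.parts_sum, Nat.sub_add_cancel hn]
  · simp
  · simp
  · intro l hl
    ext1
    exact tsub_add_cancel_of_le (Finset.mem_filter.mp hl).2
  · intro l hl
    ext1
    simp

/-- The multiset `{3, 6, …, 3 * k}`. -/
def staircase (k : ℕ) : Multiset ℕ :=
  (Multiset.range k).map fun i ↦ 3 * (i + 1)

theorem two_mul_sum_staircase (k : ℕ) : 2 * (staircase k).sum = 3 * (k * (k + 1)) := by
  induction k with
  | zero => simp [staircase]
  | succ k ih =>
    rw [staircase, Multiset.range_succ, Multiset.map_cons, Multiset.sum_cons, mul_add]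
    rw [staircase] at ih
    rw [ih]
    ring

theorem staircase_le_parts_iff {n : ℕ} (l : n.Partition) (k : ℕ) :
    staircase k ≤ l.parts ↔ ∀ i < k, 3 * (i + 1) ∈ l.parts := by
  have hnd : (staircase k).Nodup :=
    (Multiset.nodup_range k).map fun i j hij ↦ by omega
  rw [Multiset.le_iff_subset hnd]
  simp [staircase, Multiset.subset_iff]

/-- The mex is `3 * (c + 1)`, where `c` is the largest `k` with `3, 6, …, 3 * k` all parts. -/
theorem exists_mex_three_three {n : ℕ} (l : n.Partition) :
    ∃ c ≤ n, mex 3 3 l = 3 * (c + 1) ∧ ∀ k, staircase k ≤ l.parts ↔ k ≤ c := by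
  obtain ⟨⟨hpos, hmod, hnot⟩, hleast⟩ := mex_isLeast three_pos 3 l
  obtain ⟨c, hc⟩ : ∃ c, mex 3 3 l = 3 * (c + 1) := by
    rw [Nat.ModEq] at hmod
    exact ⟨mex 3 3 l / 3 - 1, by omega⟩
  have hmem (i : ℕ) (hi : i < c) : 3 * (i + 1) ∈ l.parts := by
    by_contra h
    have := hleast ⟨by omega, by simp [Nat.ModEq], h⟩
    omega
  refine ⟨c, ?_, hc, fun k ↦ ?_⟩
  · rcases c with - | c
    · omega
    · have := l.le_of_mem_parts (hmem c (by omega))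
      omega
  · rw [staircase_le_parts_iff]
    refine ⟨fun h ↦ ?_, fun h i hi ↦ hmem i (by omega)⟩
    by_contra! hlt
    exact hnot (hc ▸ h c hlt)

/-- With `c` as in `exists_mex_three_three`, the partition is counted by `mexCount 3 3 n` exactly
when `c + 1` is odd, and `c + 1` is the number of `k` for which `3, 6, …, 3 * k` are all parts. -/
theorem cast_mexCount_three_three (n : ℕ) :
    (mexCount 3 3 n : ZMod 2) = ∑ k ∈ Finset.range (n + 1),
      ((Finset.univ.filter fun l : n.Partition ↦ staircase k ≤ l.parts).card : ZMod 2) := by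
  classical
  rw [mexCount, Nat.card_eq_fintype_card, Fintype.card_subtype, Finset.card_filter, Nat.cast_sum]
  simp_rw [Finset.card_filter, Nat.cast_sum]
  rw [Finset.sum_comm]
  refine Finset.sum_congr rfl fun l _ ↦ ?_
  obtain ⟨c, hcn, hc, hle⟩ := exists_mex_three_three l
  have hfilter : (Finset.range (n + 1)).filter (fun k ↦ k ≤ c) = Finset.range (c + 1) := by
    ext k; simp only [Finset.mem_filter, Finset.mem_range]; omega
  simp_rw [hle, ← Nat.cast_sum]
  rw [← Finset.card_filter, hfilter, Finset.card_range, hc, ZMod.natCast_eq_natCast_iff]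
  by_cases h : 3 * (c + 1) ≡ 3 [MOD 2 * 3]
  · rw [if_pos h]
    simp only [Nat.ModEq] at h ⊢
    omega
  · rw [if_neg h]
    simp only [Nat.ModEq] at h ⊢
    omega

/-- The partitions containing `3, 6, …, 3 * k` are counted by the partition function at
`n - 3 * k * (k + 1) / 2`, and these shifts are the exponents of `squareSeries 24 9`. -/
theorem mk_mexCount_three_three :
    (.mk fun n ↦ (mexCount 3 3 n : ZMod 2)) =
      squareSeries 24 9 * .mk fun n ↦ (Fintype.card n.Partition : ZMod 2) := by
  ext n
  rw [coeff_mk, cast_mexCount_three_three, coeff_mul,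
    Finset.Nat.sum_antidiagonal_eq_sum_range_succ_mk,
    ← Finset.sum_filter_add_sum_filter_not _ (fun k ↦ (staircase k).sum ≤ n),
    Finset.sum_eq_zero (s := Finset.filter (fun k ↦ ¬ _) _), add_zero]
  · refine Finset.sum_of_injOn (fun k ↦ (staircase k).sum) ?_ ?_ ?_ ?_
    · intro j _ k _ h
      dsimp only at h
      have hj := two_mul_sum_staircase j
      have hk := two_mul_sum_staircase k
      nlinarith
    · intro k hk
      simp only [Finset.coe_filter, Set.mem_ofPred_eq] at hk
      simpa [Nat.lt_succ_iff] using hk.2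
    · intro a ha hk
      simp only [squareSeries, coeff_mk, ite_mul, one_mul, zero_mul, ite_eq_right_iff]
      rintro ⟨s, hs⟩
      refine absurd ?_ hk
      obtain ⟨y, ⟨k, rfl⟩, rfl⟩ := exists_odd_of_mul_self_eq hs
      have hk := two_mul_sum_staircase k
      have hka : (staircase k).sum = a := by nlinarith
      have han := Finset.mem_range.mp ha
      refine ⟨k, ?_, hka⟩
      simp only [Finset.coe_filter, Set.mem_ofPred_eq, Finset.mem_range, hka]
      exact ⟨by nlinarith, by omega⟩
    · intro k hk
      have hsq : IsSquare (24 * (staircase k).sum + 9) :=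
        ⟨3 * (2 * k + 1), by linarith [two_mul_sum_staircase k]⟩
      rw [card_filter_le_parts (by simp [staircase]) (Finset.mem_filter.mp hk).2]
      simp [squareSeries, hsq]
  -- No partition of `n` contains a multiset with sum greater than `n`.
  · intro k hk
    rw [Finset.filter_false_of_mem, Finset.card_empty, Nat.cast_zero]
    intro l _ hle
    obtain ⟨u, hu⟩ := Multiset.le_iff_exists_add.mp hle
    have := congrArg Multiset.sum hu
    rw [Multiset.sum_add, l.parts_sum] at this
    have := (Finset.mem_filter.mp hk).2
    omega

/-! ### Vanishing in the residue class three modulo four -/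

theorem mexCount_three_three_four_mul_add_three (n : ℕ) :
    mexCount 3 3 (4 * n + 3) ≡ 0 [MOD 2] := by
  rw [← ZMod.natCast_eq_natCast_iff, Nat.cast_zero]
  set P : (ZMod 2)⟦X⟧ := .mk fun n ↦ (Fintype.card n.Partition : ZMod 2) with hP
  have hPE : P * squareSeries 24 1 = 1 := by
    rw [← pentagonalSeries_zmod_two, hP, mk_card_partition_mul_pentagonalSeries]
  have hPF : P.expand 4 four_ne_zero * squareSeries 6 1 = 1 := by
    rw [← expand_squareSeries, ← map_mul, hPE, map_one]
  have hM : (.mk fun n ↦ (mexCount 3 3 n : ZMod 2)) =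
      squareSeries 24 9 * squareSeries 8 1 * P.expand 4 four_ne_zero := by
    rw [mk_mexCount_three_three, ← hP]
    -- `Ψ = E(X ^ 4) / E(X)` turns division by `E(X)` into multiplication by `Ψ` and division by
    -- `E(X ^ 4)`.
    calc squareSeries 24 9 * P
        = squareSeries 24 9 * P * (P.expand 4 four_ne_zero * squareSeries 6 1) := by
          rw [hPF, mul_one]
      _ = squareSeries 24 9 * squareSeries 8 1 * P.expand 4 four_ne_zero *
            (P * squareSeries 24 1) := by
          rw [← squareSeries_mul_eq]; ring
      _ = _ := by rw [hPE, mul_one]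
  have hcoeff := congrArg (coeff (4 * n + 3)) hM
  rw [coeff_mk, coeff_mul] at hcoeff
  rw [hcoeff]
  refine Finset.sum_eq_zero fun p hp ↦ ?_
  have hp := Finset.HasAntidiagonal.mem_antidiagonal.mp hp
  by_cases h4 : 4 ∣ p.2
  · obtain ⟨a, ha⟩ : ∃ a, p.1 = 4 * a + 3 := ⟨p.1 / 4, by omega⟩
    rw [ha, coeff_squareSeries_mul_four_mul_add_three, zero_mul]
  · rw [coeff_expand_of_not_dvd 4 _ _ h4, mul_zero]

end MexPartition

theorem mainTheorem6 :
    (∀ n : ℕ, MexPartition.mexCount 3 3 (16 * n + 11) ≡ 0 [MOD 2] ∧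
      MexPartition.mexCount 3 3 (16 * n + 15) ≡ 0 [MOD 2]) ∧
    (∀ n : ℕ,
      (¬ ∃ a b : ℕ, MexPartition.IsPentagonal a ∧ MexPartition.IsPentagonal b ∧
        n = a + 4 * b) →
      MexPartition.mexCount 3 3 (16 * n + 3) ≡ 0 [MOD 2]) ∧
    (∀ n : ℕ,
      (¬ ∃ a b : ℕ, MexPartition.IsPentagonal a ∧ MexPartition.IsTriangular b ∧
        n = 2 * a + 3 * b) →
      MexPartition.mexCount 3 3 (16 * n + 7) ≡ 0 [MOD 2]) := by
  have key (m n : ℕ) (h : m = 4 * n + 3) : MexPartition.mexCount 3 3 m ≡ 0 [MOD 2] :=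
    h ▸ MexPartition.mexCount_three_three_four_mul_add_three n
  exact ⟨fun n ↦ ⟨key _ (4 * n + 2) (by omega), key _ (4 * n + 3) (by omega)⟩,
    fun n _ ↦ key _ (4 * n) (by omega), fun n _ ↦ key _ (4 * n + 1) (by omega)⟩
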